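/- Let $W$ be a finite Coxeter group with set $S$ of simple reflections and length function $\ell$, and write $J^x=x^{-1}Jx$. For $J\subseteq S$ put $X_J=\{x\in W:\ell(sx)>\ell(x)\text{ for all }s\in J\}$, $X_J^{\sharp}=\{x\in X_J: J^x\subseteq S\}$ and $x_J=\sum_{x\in X_J}x^{-1}\in\mathbb{Q}W$. The descent algebra $\Sigma(W)$ is the $\mathbb{Q}$-span of the elements $x_J$, $J\subseteq S$; it is a subalgebra of $\mathbb{Q}W$. Let $[J]=\{J^x:x\in X_J^{\sharp}\}$ be the class of $J$, let $\Lambda=\{[J]:J\subseteq S\}$ be the set of all classes, and for $\lambda\in\Lambda$ let $|\lambda|$ be the common cardinality of the members of $\lambda$. For $K,L\subseteq S$ put $m_{KL}=|X_K\cap X_L^{\sharp}|$ if $L\subseteq K$ and $m_{KL}=0$ otherwise. The elements $e_L$ $(L\subseteq S)$ are defined by the invertible triangular system $x_K=\sum_{L\subseteq S}m_{KL}e_L$ $(K\subseteq S)$, and $e_\lambda=\sum_{L\in\lambda}e_L$ for $\lambda\in\Lambda$. Theorem. Suppose that the longest element $w_0$ of $W$ is central in $W$. 1. If $\lambda,\mu\in\Lambda$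 are such that $|\lambda|\not\equiv|\mu|\pmod 2$, then $e_\mu\,\Sigma(W)\,e_\lambda=0$. 2. $w_0=\sum_{\lambda\in\Lambda}(-1)^{|\lambda|}e_\lambda$. 3. The elements $\epsilon^{\pm}=\tfrac12(1\pm w_0)$ lie in $\Sigma(W)$ and are central in it. They are idempotents with $\epsilon^+\epsilon^-=\epsilon^-\epsilon^+=0$ and $\epsilon^++\epsilon^-=1$, and $\epsilon^+=\sum_{|\lambda|\text{ even}}e_\lambda$ and $\epsilon^-=\sum_{|\lambda|\text{ odd}}e_\lambda$. 4. Let $\Sigma(W)^+$ and $\Sigma(W)^-$ be the two-sided ideals of $\Sigma(W)$ generated by the $e_\lambda$ with $|\lambda|$ even and by the $e_\lambda$ with $|\lambda|$ odd, respectively. Then $\Sigma(W)^{\pm}=\epsilon^{\pm}\Sigma(W)$, and $\Sigma(W)=\Sigma(W)^+\oplus\Sigma(W)^-$ as algebras: the sum is direct as a sum of subspaces, and $\Sigma(W)^+\Sigma(W)^-=\Sigma(W)^-\Sigma(W)^+=0$. -/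

import Mathlib

noncomputable section

namespace DescentAlgebra

variable {B W : Type*} [Group W] [Fintype W] [DecidableEq W] {M : CoxeterMatrix B}

open Classical in
/-- The set `S` of simple reflections, as a finite subset of `W`. -/
def simples (cs : CoxeterSystem M W) : Finset W :=
  Finset.univ.filter fun s => ∃ i, cs.simple i = s

/-- The conjugate `J ^ x = {x⁻¹ s x : s ∈ J}`. -/
def conj (J : Finset W) (x : W) : Finset W :=
  J.image fun s => x⁻¹ * s * x

/-- `X_J = {x : ℓ (s x) > ℓ x for all s ∈ J}`, the minimal length right coset representatives
of `W_J`. -/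
def minReps (cs : CoxeterSystem M W) (J : Finset W) : Finset W :=
  Finset.univ.filter fun x => ∀ s ∈ J, cs.length x < cs.length (s * x)

/-- `X_J^♯ = {x ∈ X_J : J ^ x ⊆ S}`. -/
def sharpReps (cs : CoxeterSystem M W) (J : Finset W) : Finset W :=
  (minReps cs J).filter fun x => conj J x ⊆ simples cs

/-- `x_J`, the sum in `ℚ W` of the inverses of the elements of `X_J`. -/
def xElt (cs : CoxeterSystem M W) (J : Finset W) : MonoidAlgebra ℚ W :=
  ∑ w ∈ minReps cs J, MonoidAlgebra.of ℚ W w⁻¹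

/-- The descent algebra `Σ(W)`: the subspace of `ℚ W` spanned by the `x_J`, `J ⊆ S`. -/
def descentAlgebra (cs : CoxeterSystem M W) : Submodule ℚ (MonoidAlgebra ℚ W) :=
  Submodule.span ℚ {a | ∃ J ⊆ simples cs, a = xElt cs J}

/-- `m_{KL} = |X_K ∩ X_L^♯|` if `L ⊆ K`, and `0` otherwise. -/
def mCoeff (cs : CoxeterSystem M W) (K L : Finset W) : ℚ :=
  if L ⊆ K then ((minReps cs K ∩ sharpReps cs L).card : ℚ) else 0

/-- The elements `e_L`: the solution of the triangular system `x_K = ∑_{L ⊆ S} m_{KL} e_L`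
(for `K ⊆ S`), solved recursively for `e_K`; see `xElt_eq_sum` and `eElt_unique`. -/
def eElt (cs : CoxeterSystem M W) (K : Finset W) : MonoidAlgebra ℚ W :=
  (mCoeff cs K K)⁻¹ •
    (xElt cs K - ∑ L ∈ K.ssubsets.attach, mCoeff cs K L.1 • eElt cs L.1)
termination_by K.card
decreasing_by exact Finset.card_lt_card (Finset.mem_ssubsets.mp L.2)

/-- The class `[J] = {J ^ x : x ∈ X_J^♯}`. -/
def shape (cs : CoxeterSystem M W) (J : Finset W) : Finset (Finset W) :=
  (sharpReps cs J).image (conj J)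

/-- `Λ = {[J] : J ⊆ S}`. -/
def shapes (cs : CoxeterSystem M W) : Finset (Finset (Finset W)) :=
  (simples cs).powerset.image (shape cs)

/-- `|λ|`, the common cardinality of the members of the class `λ`;
see `shapeNorm_eq_card`. -/
def shapeNorm (lam : Finset (Finset W)) : ℕ :=
  lam.sup Finset.card

/-- `e_λ = ∑_{L ∈ λ} e_L`. -/
def eShape (cs : CoxeterSystem M W) (lam : Finset (Finset W)) : MonoidAlgebra ℚ W :=
  ∑ L ∈ lam, eElt cs L

/-- `Σ(W)⁺`: the two-sided ideal `Σ(W) ⟨e_λ : |λ| even⟩ Σ(W)` of `Σ(W)` generated by the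
idempotents `e_λ` with `|λ|` even. -/
def evenPart (cs : CoxeterSystem M W) : Submodule ℚ (MonoidAlgebra ℚ W) :=
  descentAlgebra cs *
    Submodule.span ℚ {a | ∃ lam ∈ shapes cs, Even (shapeNorm lam) ∧ a = eShape cs lam} *
    descentAlgebra cs

/-- `Σ(W)⁻`: the two-sided ideal `Σ(W) ⟨e_λ : |λ| odd⟩ Σ(W)` of `Σ(W)` generated by the
idempotents `e_λ` with `|λ|` odd. -/
def oddPart (cs : CoxeterSystem M W) : Submodule ℚ (MonoidAlgebra ℚ W) :=
  descentAlgebra cs *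
    Submodule.span ℚ {a | ∃ lam ∈ shapes cs, Odd (shapeNorm lam) ∧ a = eShape cs lam} *
    descentAlgebra cs

/-- `(1 + w) / 2` in `ℚ W`. -/
def epsPlus (w : W) : MonoidAlgebra ℚ W :=
  (1 / 2 : ℚ) • (1 + MonoidAlgebra.of ℚ W w)

/-- `(1 - w) / 2` in `ℚ W`. -/
def epsMinus (w : W) : MonoidAlgebra ℚ W :=
  (1 / 2 : ℚ) • (1 - MonoidAlgebra.of ℚ W w)

theorem card_conj (J : Finset W) (x : W) : (conj J x).card = J.card := by
  refine Finset.card_image_of_injective _ fun a b h => ?_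
  simpa using h

/-- The members of `[J]` all have `|J|` elements, so `|[J]|` is their common cardinality. -/
theorem shapeNorm_eq_card (cs : CoxeterSystem M W) {J L : Finset W} (hL : L ∈ shape cs J) :
    shapeNorm (shape cs J) = L.card := by
  have key : ∀ K ∈ shape cs J, K.card = J.card := by
    intro K hK
    obtain ⟨x, -, rfl⟩ := Finset.mem_image.mp hK
    exact card_conj J x
  refine le_antisymm (Finset.sup_le fun K hK => ?_) (Finset.le_sup (f := Finset.card) hL)
  rw [key K hK, key L hL]

theorem mCoeff_self_ne_zero (cs : CoxeterSystem M W) {K : Finset W} (hK : K ⊆ simples cs) :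
    mCoeff cs K K ≠ 0 := by
  have hconj : conj K 1 = K := by simp [conj]
  have h1 : (1 : W) ∈ minReps cs K := by
    simp only [minReps, Finset.mem_filter, Finset.mem_univ, true_and]
    intro s hs
    have hs' := hK hs
    simp only [simples, Finset.mem_filter, Finset.mem_univ, true_and] at hs'
    obtain ⟨i, rfl⟩ := hs'
    simp
  have h2 : (1 : W) ∈ minReps cs K ∩ sharpReps cs K := by
    refine Finset.mem_inter.mpr ⟨h1, Finset.mem_filter.mpr ⟨h1, ?_⟩⟩
    rw [hconj]
    exact hK
  rw [mCoeff, if_pos (Finset.Subset.refl K)]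
  exact_mod_cast (Finset.card_pos.mpr ⟨1, h2⟩).ne'

theorem sum_mCoeff (cs : CoxeterSystem M W) {K : Finset W} (hK : K ⊆ simples cs)
    (f : Finset W → MonoidAlgebra ℚ W) :
    ∑ L ∈ (simples cs).powerset, mCoeff cs K L • f L =
      mCoeff cs K K • f K + ∑ L ∈ K.ssubsets, mCoeff cs K L • f L := by
  have h1 : ∑ L ∈ (simples cs).powerset, mCoeff cs K L • f L =
      ∑ L ∈ K.powerset, mCoeff cs K L • f L := by
    refine (Finset.sum_subset (Finset.powerset_mono.mpr hK) fun L _ hL => ?_).symm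
    rw [mCoeff, if_neg (fun h => hL (Finset.mem_powerset.mpr h)), zero_smul]
  rw [h1, Finset.ssubsets, Finset.add_sum_erase _ (fun L => mCoeff cs K L • f L)
    (Finset.mem_powerset_self K)]

/-- The elements `e_L` satisfy the defining conditions `x_K = ∑_{L ⊆ S} m_{KL} e_L`. -/
theorem xElt_eq_sum (cs : CoxeterSystem M W) {K : Finset W} (hK : K ⊆ simples cs) :
    xElt cs K = ∑ L ∈ (simples cs).powerset, mCoeff cs K L • eElt cs L := by
  rw [sum_mCoeff cs hK, eElt, smul_inv_smul₀ (mCoeff_self_ne_zero cs hK),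
    Finset.sum_attach K.ssubsets (fun L => mCoeff cs K L • eElt cs L), sub_add_cancel]

/-- The elements `e_L` are the only ones that satisfy these conditions. -/
theorem eElt_unique (cs : CoxeterSystem M W) (f : Finset W → MonoidAlgebra ℚ W)
    (hf : ∀ K ⊆ simples cs,
      xElt cs K = ∑ L ∈ (simples cs).powerset, mCoeff cs K L • f L)
    {K : Finset W} (hK : K ⊆ simples cs) : f K = eElt cs K := by
  induction K using Finset.strongInduction with
  | H K ih =>
    have h := (hf K hK).symm.trans (xElt_eq_sum cs hK)
    rw [sum_mCoeff cs hK, sum_mCoeff cs hK] at h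
    have h2 : ∑ L ∈ K.ssubsets, mCoeff cs K L • f L =
        ∑ L ∈ K.ssubsets, mCoeff cs K L • eElt cs L := by
      refine Finset.sum_congr rfl fun L hL => ?_
      have hL' := Finset.mem_ssubsets.mp hL
      rw [ih L hL' (hL'.1.trans hK)]
    rw [h2] at h
    exact smul_right_injective _ (mCoeff_self_ne_zero cs hK) (add_right_cancel h)

end DescentAlgebra

end

/-! Everything rests on the eigenvector relation `w₀ e_L = (-1)^|L| e_L` (`longest_mul_eElt`). Right
multiplication by `w₀` complements inversion sets, so inclusion-exclusion gives `w₀ x_K = ∑_{J ⊆ K}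
(-1)^|J| x_J`. After expanding each `x_J`, the coefficient of `e_L` is `(-1)^|L|` times the number
of `x ∈ X_L^♯` whose ascents in `K` are exactly `L`. With `w_L` longest in `W_L`, the involution `x
↦ w_L x w₀` matches these with `X_K ∩ X_L^♯`; centrality of `w₀` makes it preserve `X_L^♯`. The
coefficient is therefore `(-1)^|L| m_{KL}`, so the elements `(-1)^|L| w₀ e_L` solve the system
defining the `e_L`, and uniqueness gives the relation.

Since `X_S = {1}`, the relation for `x_S` reads `1 = ∑ e_λ`; multiplying it by `w₀` and by `(1 ±
w₀)/2` gives the expansions. The rest is formal algebra with two complementary central idempotents,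
together with Solomon's theorem that `Σ(W)` is closed under products.

The Coxeter combinatorics all comes from the cocycle property of inversion sets
(`isLeftInversion_mul_iff`). -/

namespace DescentAlgebra

/-! ### Inversion parity, the cocycle property and strong exchange -/

section Cocycle

variable {B W : Type*} [Group W] {M : CoxeterMatrix B} (cs : CoxeterSystem M W)

theorem simple_mul_rotation_pow (i j : B) (k : ℕ) :
    cs.simple j * (cs.simple i * cs.simple j) ^ k =
      ((cs.simple i * cs.simple j) ^ k)⁻¹ * cs.simple j := by
  have h1 : (cs.simple i * cs.simple j)⁻¹ = cs.simple j * cs.simple i := by simp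
  rw [← inv_pow, h1]
  induction k with
  | zero => simp
  | succ k ih => rw [pow_succ', pow_succ', mul_assoc _ _ (cs.simple j), ← ih]; simp [mul_assoc]

/-- `s_j` inverts the rotation `s_i s_j`, so conjugation doubles the exponent. The cases `m = 0, 1`
identify the two terms gained in each step of `reflStep_mul_pow`. -/
theorem conj_rotation_pow_eq_iff (i j : B) (t : W) (k m : ℕ) :
    (cs.simple i * cs.simple j) ^ k * t * ((cs.simple i * cs.simple j) ^ k)⁻¹ =
        ((cs.simple i * cs.simple j) ^ m)⁻¹ * cs.simple j ↔
      t = ((cs.simple i * cs.simple j) ^ (2 * k + m))⁻¹ * cs.simple j := by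
  rw [mul_inv_eq_iff_eq_mul, mul_assoc _ (cs.simple j), simple_mul_rotation_pow,
    ← eq_inv_mul_iff_mul_eq, ← mul_assoc, ← mul_assoc, ← mul_inv_rev, ← mul_inv_rev, ← pow_add,
    ← pow_add, two_mul, add_right_comm, add_assoc k m k]

variable [DecidableEq W]

/-- A simple reflection acts on `W × ZMod 2` by conjugation on the first component, and the
second component records whether the first one is the simple reflection itself. -/
def reflStep (i : B) : Equiv.Perm (W × ZMod 2) :=
  Function.Involutive.toPerm (fun p =>
    (cs.simple i * p.1 * cs.simple i, p.2 + if p.1 = cs.simple i then 1 else 0)) <| by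
    rintro ⟨t, e⟩
    have h : cs.simple i * t * cs.simple i = cs.simple i ↔ t = cs.simple i := by
      constructor
      · intro h
        rw [mul_assoc, mul_eq_left, mul_eq_one_iff_eq_inv, cs.inv_simple] at h
        exact h
      · rintro rfl
        simp
    simp only [h, add_assoc]
    refine Prod.ext (by simp [mul_assoc]) ?_
    split_ifs
    · simpa using CharTwo.add_self_eq_zero (1 : ZMod 2)
    · simp

theorem reflStep_apply (i : B) (t : W) (e : ZMod 2) :
    reflStep cs i (t, e) =
      (cs.simple i * t * cs.simple i, e + if t = cs.simple i then 1 else 0) := rfl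

theorem reflStep_mul_pow (i j : B) (n : ℕ) (t : W) (e : ZMod 2) :
    ((reflStep cs i * reflStep cs j) ^ n) (t, e) =
      ((cs.simple i * cs.simple j) ^ n * t * ((cs.simple i * cs.simple j) ^ n)⁻¹,
        e + ∑ k ∈ Finset.range (2 * n),
          if t = ((cs.simple i * cs.simple j) ^ k)⁻¹ * cs.simple j then 1 else 0) := by
  induction n with
  | zero => simp
  | succ n ih =>
    have h0 := conj_rotation_pow_eq_iff cs i j t n 0
    have h1 := conj_rotation_pow_eq_iff cs i j t n 1
    have h2 : ∀ g : W, cs.simple j * g * cs.simple j = cs.simple i ↔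
        g = ((cs.simple i * cs.simple j) ^ 1)⁻¹ * cs.simple j := by
      intro g
      rw [pow_one, mul_inv_rev, cs.inv_simple, cs.inv_simple]
      constructor
      · intro h
        rw [← h]
        simp [mul_assoc]
      · rintro rfl
        simp [mul_assoc]
    rw [pow_zero, inv_one, one_mul, add_zero] at h0
    rw [pow_succ', Equiv.Perm.mul_apply, ih, Equiv.Perm.mul_apply, reflStep_apply, reflStep_apply,
      mul_add, mul_one, Finset.sum_range_succ, Finset.sum_range_succ, pow_succ']
    simp only [h0, h1, h2]
    simp [mul_assoc, add_assoc]

/-- The `2 * M i j` reflections counted run twice through the same list, because the rotation has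
trivial `M i j`-th power; modulo two the counts cancel. -/
theorem reflStep_isLiftable : M.IsLiftable (reflStep cs) := by
  intro i j
  ext1 ⟨t, e⟩
  rw [reflStep_mul_pow, cs.simple_mul_simple_pow, two_mul, Finset.sum_range_add]
  simp only [pow_add, cs.simple_mul_simple_pow, one_mul]
  rw [CharTwo.add_self_eq_zero]
  simp

/-- The action of `W` on `W × ZMod 2` whose second component counts inversions modulo two. -/
def reflAction : W →* Equiv.Perm (W × ZMod 2) :=
  cs.lift ⟨reflStep cs, reflStep_isLiftable cs⟩

theorem reflAction_simple (i : B) : reflAction cs (cs.simple i) = reflStep cs i :=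
  cs.lift_apply_simple (reflStep_isLiftable cs) i

theorem reflAction_wordProd (ω : List B) (t : W) (e : ZMod 2) :
    reflAction cs (cs.wordProd ω) (t, e) =
      (cs.wordProd ω * t * (cs.wordProd ω)⁻¹, e + ((cs.rightInvSeq ω).count t : ℕ)) := by
  induction ω with
  | nil => simp
  | cons i ω ih =>
    have h : cs.wordProd ω * t * (cs.wordProd ω)⁻¹ = cs.simple i ↔
        (cs.wordProd ω)⁻¹ * cs.simple i * cs.wordProd ω = t := by
      rw [mul_inv_eq_iff_eq_mul, mul_assoc, inv_mul_eq_iff_eq_mul, eq_comm]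
    simp only [mul_assoc] at h
    rw [cs.wordProd_cons, map_mul, Equiv.Perm.mul_apply, ih, reflAction_simple, reflStep_apply,
      CoxeterSystem.rightInvSeq, List.count_cons]
    simp only [h, beq_iff_eq, Nat.cast_add, Nat.cast_ite, Nat.cast_one, Nat.cast_zero, add_assoc,
      mul_inv_rev, cs.inv_simple, mul_assoc]

/-- The parity of the number of occurrences of `t` in the right inversion sequence of a word
for `w`. -/
def invParity (w t : W) : ZMod 2 := (reflAction cs w (t, 0)).2

theorem reflAction_apply (w t : W) (e : ZMod 2) :
    reflAction cs w (t, e) = (w * t * w⁻¹, e + invParity cs w t) := by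
  obtain ⟨ω, -, rfl⟩ := cs.exists_isReduced w
  simp [invParity, reflAction_wordProd]

theorem invParity_mul (u v t : W) :
    invParity cs (u * v) t = invParity cs v t + invParity cs u (v * t * v⁻¹) := by
  rw [invParity, map_mul, Equiv.Perm.mul_apply, reflAction_apply, reflAction_apply, zero_add]

theorem invParity_one (t : W) : invParity cs 1 t = 0 := by
  simp [invParity]

theorem invParity_simple_self (i : B) : invParity cs (cs.simple i) (cs.simple i) = 1 := by
  rw [invParity, reflAction_simple, reflStep_apply]
  simp

/-- For `t = w s w⁻¹` the contributions of `w` and `w⁻¹` cancel, and the middle letter contributes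
one. -/
theorem invParity_self {t : W} (ht : cs.IsReflection t) : invParity cs t t = 1 := by
  obtain ⟨w, i, rfl⟩ := ht
  have h := invParity_mul cs w w⁻¹ (w * cs.simple i * w⁻¹)
  have e : w⁻¹ * (w * cs.simple i * w⁻¹) * w⁻¹⁻¹ = cs.simple i := by group
  rw [mul_inv_cancel, invParity_one, e] at h
  rw [invParity_mul, e, invParity_mul, invParity_simple_self]
  rw [mul_assoc (cs.simple i), mul_inv_cancel, mul_one, add_left_comm, ← h, add_zero]

theorem isRightInversion_of_invParity {w t : W} (h : invParity cs w t = 1) :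
    cs.IsRightInversion w t := by
  obtain ⟨ω, hω, rfl⟩ := cs.exists_isReduced w
  refine cs.isRightInversion_of_mem_rightInvSeq hω ?_
  rw [invParity, reflAction_wordProd] at h
  by_contra hn
  simp [List.count_eq_zero_of_not_mem hn] at h

/-- If the parity at `w` is zero, it is one at `w * t`; then `t` is an inversion of `w * t`, hence
not of `w`. -/
theorem isRightInversion_iff_invParity {w t : W} (ht : cs.IsReflection t) :
    cs.IsRightInversion w t ↔ invParity cs w t = 1 := by
  refine ⟨fun h => ?_, isRightInversion_of_invParity cs⟩
  by_contra hn
  have h0 : invParity cs w t = 0 := by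
    generalize invParity cs w t = a at hn ⊢
    revert a
    decide
  refine (ht.isRightInversion_mul_left_iff.1 ?_) h
  apply isRightInversion_of_invParity
  rw [invParity_mul, invParity_self cs ht, mul_assoc, mul_inv_cancel, mul_one, h0, add_zero]

omit [DecidableEq W] in
/-- The cocycle property of inversion sets. -/
theorem isLeftInversion_mul_iff {t : W} (ht : cs.IsReflection t) (u v : W) :
    cs.IsLeftInversion (u * v) t ↔
      ¬(cs.IsLeftInversion u t ↔ cs.IsLeftInversion v (u⁻¹ * t * u)) := by
  classical
  have ht' : cs.IsReflection (u⁻¹ * t * u) := by simpa using ht.conj u⁻¹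
  rw [← cs.isRightInversion_inv_iff, ← cs.isRightInversion_inv_iff, ← cs.isRightInversion_inv_iff,
    isRightInversion_iff_invParity cs ht, isRightInversion_iff_invParity cs ht,
    isRightInversion_iff_invParity cs ht', mul_inv_rev, invParity_mul, inv_inv]
  generalize invParity cs u⁻¹ t = a
  generalize invParity cs v⁻¹ (u⁻¹ * t * u) = b
  revert a b
  decide

omit [DecidableEq W] in
/-- The strong exchange property. -/
theorem mem_rightInvSeq_of_isRightInversion {ω : List B} {t : W}
    (h : cs.IsRightInversion (cs.wordProd ω) t) : t ∈ cs.rightInvSeq ω := by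
  classical
  have h1 := (isRightInversion_iff_invParity cs h.1).1 h
  rw [invParity, reflAction_wordProd] at h1
  by_contra hn
  simp [List.count_eq_zero_of_not_mem hn] at h1

end Cocycle
end DescentAlgebra

namespace DescentAlgebra

/-! ### Standard parabolic subgroups -/

section Parabolic

variable {B W : Type*} [Group W] {M : CoxeterMatrix B} (cs : CoxeterSystem M W)

theorem isReflection_of_mem_range {s : W} (hs : s ∈ Set.range cs.simple) : cs.IsReflection s := by
  obtain ⟨i, rfl⟩ := hs
  exact cs.isReflection_simple i

theorem mul_self_of_mem_range {s : W} (hs : s ∈ Set.range cs.simple) : s * s = 1 :=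
  (isReflection_of_mem_range cs hs).mul_self

theorem inv_of_mem_range {s : W} (hs : s ∈ Set.range cs.simple) : s⁻¹ = s :=
  (isReflection_of_mem_range cs hs).inv

theorem length_of_mem_range {s : W} (hs : s ∈ Set.range cs.simple) : cs.length s = 1 := by
  obtain ⟨i, rfl⟩ := hs
  exact cs.length_simple i

theorem isLeftInversion_iff_length_lt {w s : W} (hs : s ∈ Set.range cs.simple) :
    cs.IsLeftInversion w s ↔ cs.length (s * w) < cs.length w :=
  and_iff_right (isReflection_of_mem_range cs hs)

theorem length_simple_mul_cases {s : W} (hs : s ∈ Set.range cs.simple) (w : W) :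
    (cs.IsLeftInversion w s ∧ cs.length (s * w) + 1 = cs.length w) ∨
      (¬cs.IsLeftInversion w s ∧ cs.length (s * w) = cs.length w + 1) := by
  rw [isLeftInversion_iff_length_lt cs hs]
  obtain ⟨i, rfl⟩ := hs
  have := cs.length_simple_mul w i
  omega

theorem isLeftInversion_simple_iff {s t : W} (hs : s ∈ Set.range cs.simple) :
    cs.IsLeftInversion s t ↔ t = s := by
  constructor
  · intro h
    obtain ⟨i, rfl⟩ := hs
    have h2 := cs.isRightInversion_inv_iff.2 h
    have h3 := mem_rightInvSeq_of_isRightInversion cs (ω := [i]) (t := t) (by simpa using h2)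
    simpa using h3
  · rintro rfl
    rw [isLeftInversion_iff_length_lt cs hs, mul_self_of_mem_range cs hs, cs.length_one,
      length_of_mem_range cs hs]
    exact Nat.one_pos

theorem not_isLeftInversion_one (t : W) : ¬cs.IsLeftInversion 1 t := by
  rintro ⟨-, h⟩
  simp at h

variable {J : Set W}

theorem closure_simple_induction (hJ : J ⊆ Set.range cs.simple) {p : W → Prop} (one : p 1)
    (mul : ∀ s ∈ J, ∀ a ∈ Subgroup.closure J, p a → p (s * a)) {a : W}
    (ha : a ∈ Subgroup.closure J) : p a := by
  induction ha using Subgroup.closure_induction_left with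
  | one => exact one
  | mul_left s hs a ha ih => exact mul s hs a ha ih
  | inv_mul_cancel s hs a ha ih =>
    rw [inv_of_mem_range cs (hJ hs)]
    exact mul s hs a ha ih

/-- Inversions of elements of a standard parabolic subgroup lie in that subgroup. -/
theorem mem_closure_of_isLeftInversion (hJ : J ⊆ Set.range cs.simple) {a t : W}
    (ha : a ∈ Subgroup.closure J) (h : cs.IsLeftInversion a t) : t ∈ Subgroup.closure J := by
  revert t
  refine closure_simple_induction cs hJ (p := fun a => ∀ {t : W}, cs.IsLeftInversion a t →
    t ∈ Subgroup.closure J) (fun h => (not_isLeftInversion_one cs _ h).elim) ?_ ha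
  intro s hs a _ ih t h
  have hs' := Subgroup.subset_closure hs
  rw [isLeftInversion_mul_iff cs h.1, isLeftInversion_simple_iff cs (hJ hs)] at h
  by_cases hts : t = s
  · rwa [hts]
  · have h1 := ih (of_not_not fun hn => h (iff_of_false hts hn))
    have h2 := mul_mem (mul_mem hs' h1) (inv_mem hs')
    simpa [mul_assoc] using h2

/-- A nontrivial element of a standard parabolic subgroup has a left descent among the
generators of that subgroup. -/
theorem exists_isLeftInversion_of_mem_closure (hJ : J ⊆ Set.range cs.simple) {a : W}
    (ha : a ∈ Subgroup.closure J) (h1 : a ≠ 1) : ∃ s ∈ J, cs.IsLeftInversion a s := by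
  -- A reduced word in letters from `J` exists: a new first letter either lengthens the word or, by
  -- strong exchange, deletes one of its letters. Its first letter is the desired descent.
  have key : ∃ ω : List B, cs.IsReduced ω ∧ (∀ i ∈ ω, cs.simple i ∈ J) ∧ a = cs.wordProd ω := by
    refine closure_simple_induction cs hJ (p := fun a => ∃ ω : List B, cs.IsReduced ω ∧
      (∀ i ∈ ω, cs.simple i ∈ J) ∧ a = cs.wordProd ω) ⟨[], by simp [CoxeterSystem.IsReduced]⟩ ?_ ha
    rintro s hs _ - ⟨ω, hω, hωJ, rfl⟩
    obtain ⟨i, rfl⟩ := hJ hs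
    rcases length_simple_mul_cases cs ⟨i, rfl⟩ (cs.wordProd ω) with ⟨h, hl⟩ | ⟨-, hl⟩
    · rw [← cs.isRightInversion_inv_iff, ← cs.wordProd_reverse] at h
      have hm := mem_rightInvSeq_of_isRightInversion cs h
      rw [cs.rightInvSeq_reverse, List.mem_reverse] at hm
      obtain ⟨j, hj, hj'⟩ := List.mem_iff_getElem.1 hm
      have he := cs.getD_leftInvSeq_mul_wordProd ω j
      rw [List.getD_eq_getElem _ _ hj, hj'] at he
      rw [cs.length_leftInvSeq] at hj
      refine ⟨ω.eraseIdx j, ?_, fun k hk => hωJ k (List.mem_of_mem_eraseIdx hk), he⟩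
      rw [he, hω.eq, ← List.length_eraseIdx_add_one hj] at hl
      exact Nat.succ_injective hl
    · refine ⟨i :: ω, ?_, ?_, (cs.wordProd_cons i ω).symm⟩
      · rw [CoxeterSystem.IsReduced, cs.wordProd_cons, hl, hω.eq, List.length_cons]
      · simpa using ⟨hs, hωJ⟩
  obtain ⟨ω, hω, hωJ, rfl⟩ := key
  cases ω with
  | nil => simp at h1
  | cons i ω =>
    refine ⟨cs.simple i, hωJ i (by simp), ?_⟩
    rw [isLeftInversion_iff_length_lt cs ⟨i, rfl⟩, hω.eq, cs.wordProd_cons]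
    have := cs.length_wordProd_le ω
    simpa using Nat.lt_succ_of_le this

theorem mem_of_mem_closure_of_mem_range (hJ : J ⊆ Set.range cs.simple) {s : W}
    (hs : s ∈ Set.range cs.simple) (h : s ∈ Subgroup.closure J) : s ∈ J := by
  have h1 : s ≠ 1 := by
    rintro rfl
    simpa using length_of_mem_range cs hs
  obtain ⟨r, hr, hsr⟩ := exists_isLeftInversion_of_mem_closure cs hJ h h1
  rw [isLeftInversion_simple_iff cs hs] at hsr
  rwa [← hsr]

theorem conj_mem_closure {s a : W} (ha : a ∈ Subgroup.closure J) (hs : s ∈ J) :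
    a⁻¹ * s * a ∈ Subgroup.closure J :=
  mul_mem (mul_mem (inv_mem ha) (Subgroup.subset_closure hs)) ha

/-- By the cocycle property, `s ∈ J` is a descent of `a * d` exactly when it is one of `a`, so both
lengths change alike as `a` is built up. In the next lemma they change oppositely. -/
theorem length_mul_of_no_isLeftInversion (hJ : J ⊆ Set.range cs.simple) {a d : W}
    (ha : a ∈ Subgroup.closure J) (hd : ∀ t ∈ Subgroup.closure J, ¬cs.IsLeftInversion d t) :
    cs.length (a * d) = cs.length a + cs.length d := by
  refine closure_simple_induction cs hJ
    (p := fun a => cs.length (a * d) = cs.length a + cs.length d) (by simp) ?_ ha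
  intro s hs a ha ih
  have h := isLeftInversion_mul_iff cs (isReflection_of_mem_range cs (hJ hs)) a d
  have h' := hd _ (conj_mem_closure ha hs)
  rw [mul_assoc]
  rcases length_simple_mul_cases cs (hJ hs) a with h1 | h1 <;>
  rcases length_simple_mul_cases cs (hJ hs) (a * d) with h2 | h2 <;>
  grind

theorem length_mul_of_forall_isLeftInversion (hJ : J ⊆ Set.range cs.simple) {a d : W}
    (ha : a ∈ Subgroup.closure J)
    (hd : ∀ t ∈ Subgroup.closure J, cs.IsReflection t → cs.IsLeftInversion d t) :
    cs.length (a * d) + cs.length a = cs.length d := by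
  refine closure_simple_induction cs hJ
    (p := fun a => cs.length (a * d) + cs.length a = cs.length d) (by simp) ?_ ha
  intro s hs a ha ih
  have hr := isReflection_of_mem_range cs (hJ hs)
  have h := isLeftInversion_mul_iff cs hr a d
  have h' := hd _ (conj_mem_closure ha hs) (by simpa using hr.conj a⁻¹)
  rw [mul_assoc]
  rcases length_simple_mul_cases cs (hJ hs) a with h1 | h1 <;>
  rcases length_simple_mul_cases cs (hJ hs) (a * d) with h2 | h2 <;>
  grind

/-- A minimal length element of a right coset of a standard parabolic subgroup has no
inversions in that subgroup. -/
theorem exists_mul_no_isLeftInversion (J : Set W) (w : W) :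
    ∃ a ∈ Subgroup.closure J, ∃ d, (∀ t ∈ Subgroup.closure J, ¬cs.IsLeftInversion d t) ∧
      w = a * d := by
  obtain ⟨a, ha, hmin⟩ := (InvImage.wf (fun a : W => cs.length (a * w)) wellFounded_lt).has_min
    (Subgroup.closure J : Set W) ⟨1, one_mem _⟩
  refine ⟨a⁻¹, inv_mem ha, a * w, fun t ht h => ?_, by group⟩
  refine hmin (t * a) (mul_mem ht ha) ?_
  change cs.length (t * a * w) < cs.length (a * w)
  rw [mul_assoc]
  exact h.2

/-- Write `d = a * e` with `e` free of inversions in `W_J`. If `a ≠ 1`, a descent of `a` in `J` is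
one of `d`, as lengths add. -/
theorem no_isLeftInversion_of_forall_mem (hJ : J ⊆ Set.range cs.simple) {d : W}
    (hd : ∀ s ∈ J, ¬cs.IsLeftInversion d s) {t : W} (ht : t ∈ Subgroup.closure J) :
    ¬cs.IsLeftInversion d t := by
  obtain ⟨a, ha, e, he, rfl⟩ := exists_mul_no_isLeftInversion cs J d
  rcases eq_or_ne a 1 with rfl | h1
  · rw [one_mul]
    exact he t ht
  · obtain ⟨s, hs, h⟩ := exists_isLeftInversion_of_mem_closure cs hJ ha h1
    refine (hd s hs ?_).elim
    rw [isLeftInversion_iff_length_lt cs (hJ hs)] at h ⊢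
    rw [← mul_assoc, length_mul_of_no_isLeftInversion cs hJ ha he,
      length_mul_of_no_isLeftInversion cs hJ (mul_mem (Subgroup.subset_closure hs) ha) he]
    omega

end Parabolic
end DescentAlgebra

namespace DescentAlgebra

/-! ### Minimal coset representatives -/

section MinReps

variable {B W : Type*} [Group W] [Fintype W] [DecidableEq W] {M : CoxeterMatrix B}
  (cs : CoxeterSystem M W)

omit [DecidableEq W] in
theorem mem_simples {s : W} : s ∈ simples cs ↔ s ∈ Set.range cs.simple := by
  simp [simples]

variable {I J K : Finset W}

omit [DecidableEq W] in
theorem coe_subset_range (hJ : J ⊆ simples cs) : (J : Set W) ⊆ Set.range cs.simple :=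
  fun _ hs => (mem_simples cs).1 (hJ hs)

theorem mem_minReps (hJ : J ⊆ simples cs) {x : W} :
    x ∈ minReps cs J ↔ ∀ s ∈ J, ¬cs.IsLeftInversion x s := by
  simp only [minReps, Finset.mem_filter, Finset.mem_univ, true_and]
  refine forall₂_congr fun s hs => ?_
  rcases length_simple_mul_cases cs (coe_subset_range cs hJ hs) x with h | h <;> simp [h.1] <;> omega

theorem no_isLeftInversion_of_mem_minReps (hJ : J ⊆ simples cs) {d : W} (hd : d ∈ minReps cs J)
    {t : W} (ht : t ∈ Subgroup.closure (J : Set W)) : ¬cs.IsLeftInversion d t :=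
  no_isLeftInversion_of_forall_mem cs (coe_subset_range cs hJ) ((mem_minReps cs hJ).1 hd) ht

theorem length_mul_of_mem_minReps (hJ : J ⊆ simples cs) {a d : W}
    (ha : a ∈ Subgroup.closure (J : Set W)) (hd : d ∈ minReps cs J) :
    cs.length (a * d) = cs.length a + cs.length d :=
  length_mul_of_no_isLeftInversion cs (coe_subset_range cs hJ) ha
    fun _ => no_isLeftInversion_of_mem_minReps cs hJ hd

theorem isLeftInversion_mul_iff_of_mem_minReps (hJ : J ⊆ simples cs) {a d s : W}
    (ha : a ∈ Subgroup.closure (J : Set W)) (hd : d ∈ minReps cs J) (hs : s ∈ J) :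
    cs.IsLeftInversion (a * d) s ↔ cs.IsLeftInversion a s := by
  rw [isLeftInversion_mul_iff cs (isReflection_of_mem_range cs (coe_subset_range cs hJ hs)),
    iff_false_right (no_isLeftInversion_of_mem_minReps cs hJ hd (conj_mem_closure ha hs)), not_not]

theorem exists_mul_minReps (hJ : J ⊆ simples cs) (w : W) :
    ∃ a ∈ Subgroup.closure (J : Set W), ∃ d ∈ minReps cs J, w = a * d := by
  obtain ⟨a, ha, d, hd, rfl⟩ := exists_mul_no_isLeftInversion cs (J : Set W) w
  exact ⟨a, ha, d, (mem_minReps cs hJ).2 fun s hs => hd s (Subgroup.subset_closure hs), rfl⟩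

/-- With `b = a⁻¹ * a'`, length additivity for `d = b * d'` and for `d' = b⁻¹ * d` forces `b` to
have length zero. -/
theorem mul_minReps_unique (hJ : J ⊆ simples cs) {a d a' d' : W}
    (ha : a ∈ Subgroup.closure (J : Set W)) (hd : d ∈ minReps cs J)
    (ha' : a' ∈ Subgroup.closure (J : Set W)) (hd' : d' ∈ minReps cs J)
    (h : a * d = a' * d') : a = a' ∧ d = d' := by
  have hb : a⁻¹ * a' ∈ Subgroup.closure (J : Set W) := mul_mem (inv_mem ha) ha'
  have h1 : d = a⁻¹ * a' * d' := by rw [mul_assoc, ← h]; group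
  have h2 : d' = (a⁻¹ * a')⁻¹ * d := by rw [h1]; group
  have l1 := length_mul_of_mem_minReps cs hJ hb hd'
  have l2 := length_mul_of_mem_minReps cs hJ (inv_mem hb) hd
  rw [← h1] at l1
  rw [← h2] at l2
  have h3 : a⁻¹ * a' = 1 := cs.length_eq_zero_iff.1 (by omega)
  exact ⟨(inv_mul_eq_one.1 h3), by rw [h1, h3, one_mul]⟩

omit [Fintype W] in
theorem mem_conj {J : Finset W} {x r : W} : r ∈ conj J x ↔ ∃ s ∈ J, x⁻¹ * s * x = r :=
  Finset.mem_image

omit [Fintype W] in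
theorem conj_one (J : Finset W) : conj J 1 = J := by
  simp [conj]

omit [Fintype W] in
theorem conj_conj (J : Finset W) (x y : W) : conj (conj J x) y = conj J (x * y) := by
  simp [conj, Finset.image_image, Function.comp_def, mul_assoc]

omit [Fintype W] in
theorem conj_mem_closure_conj {a : W} (x : W) (ha : a ∈ Subgroup.closure (J : Set W)) :
    x⁻¹ * a * x ∈ Subgroup.closure (conj J x : Set W) := by
  have h : Subgroup.closure (J : Set W) ≤
      (Subgroup.closure (conj J x : Set W)).comap (MulAut.conj x⁻¹).toMonoidHom := by
    rw [Subgroup.closure_le]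
    intro s hs
    refine Subgroup.subset_closure (mem_conj.2 ⟨s, hs, ?_⟩)
    simp
  simpa using h ha

/-- Left multiplication by an element of `X_J` that conjugates `J` into `S` maps the minimal
representatives for `J ^ d` onto those for `J`. -/
theorem mul_mem_minReps_iff (hJ : J ⊆ simples cs) {d : W} (hd : d ∈ minReps cs J)
    (hc : conj J d ⊆ simples cs) (y : W) :
    d * y ∈ minReps cs J ↔ y ∈ minReps cs (conj J d) := by
  have key : ∀ s ∈ J, (cs.IsLeftInversion (d * y) s ↔ cs.IsLeftInversion y (d⁻¹ * s * d)) := by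
    intro s hs
    rw [isLeftInversion_mul_iff cs (isReflection_of_mem_range cs (coe_subset_range cs hJ hs)),
      not_iff, iff_true_left ((mem_minReps cs hJ).1 hd s hs)]
  rw [mem_minReps cs hJ, mem_minReps cs hc]
  constructor
  · intro h r hr
    obtain ⟨s, hs, rfl⟩ := mem_conj.1 hr
    rw [← key s hs]
    exact h s hs
  · intro h s hs
    rw [key s hs]
    exact h _ (mem_conj.2 ⟨s, hs, rfl⟩)

theorem xElt_mul_of (hJ : J ⊆ simples cs) {d : W} (hd : d ∈ minReps cs J)
    (hc : conj J d ⊆ simples cs) :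
    xElt cs J * MonoidAlgebra.of ℚ W d = xElt cs (conj J d) := by
  rw [xElt, xElt, Finset.sum_mul]
  refine Finset.sum_bij' (fun x _ => d⁻¹ * x) (fun y _ => d * y) ?_ ?_ ?_ ?_ ?_
  · intro x hx
    rw [← mul_mem_minReps_iff cs hJ hd hc]
    simpa using hx
  · intro y hy
    rwa [mul_mem_minReps_iff cs hJ hd hc]
  · simp
  · simp
  · intro x _
    rw [← map_mul, mul_inv_rev, inv_inv]

end MinReps

/-! ### Solomon's product formula -/

section Product

variable {B W : Type*} [Group W] [Fintype W] [DecidableEq W] {M : CoxeterMatrix B}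
  (cs : CoxeterSystem M W) {I J K : Finset W}

open Classical in
/-- The minimal length representatives of the right cosets of `W_I` in `W_J`. -/
noncomputable def relMinReps (J I : Finset W) : Finset W :=
  (minReps cs I).filter fun b => b ∈ Subgroup.closure (J : Set W)

theorem mem_relMinReps {b : W} :
    b ∈ relMinReps cs J I ↔ b ∈ minReps cs I ∧ b ∈ Subgroup.closure (J : Set W) := by
  simp [relMinReps]

/-- Elements of `X_I` factor uniquely as `b * u` with `u ∈ X_J` and `b ∈ W_J ∩ X_I`; inversion
reverses the factors. -/
theorem xElt_eq_mul_relMinReps (hJ : J ⊆ simples cs) (hI : I ⊆ J) :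
    xElt cs I = xElt cs J * ∑ b ∈ relMinReps cs J I, MonoidAlgebra.of ℚ W b⁻¹ := by
  symm
  rw [xElt, xElt, Finset.sum_mul_sum, ← Finset.sum_product']
  have key : ∀ b u : W, u ∈ minReps cs J → b ∈ Subgroup.closure (J : Set W) →
      (b * u ∈ minReps cs I ↔ b ∈ minReps cs I) := by
    intro b u hu hb
    rw [mem_minReps cs (hI.trans hJ), mem_minReps cs (hI.trans hJ)]
    refine forall₂_congr fun s hs => ?_
    rw [isLeftInversion_mul_iff_of_mem_minReps cs hJ hb hu (hI hs)]
  refine Finset.sum_bij (fun p _ => p.2 * p.1) ?_ ?_ ?_ ?_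
  · rintro ⟨u, b⟩ h
    obtain ⟨hu, hb⟩ := Finset.mem_product.1 h
    rw [mem_relMinReps] at hb
    exact (key b u hu hb.2).2 hb.1
  · rintro ⟨u, b⟩ h ⟨u', b'⟩ h' he
    obtain ⟨hu, hb⟩ := Finset.mem_product.1 h
    obtain ⟨hu', hb'⟩ := Finset.mem_product.1 h'
    rw [mem_relMinReps] at hb hb'
    obtain ⟨h1, h2⟩ := mul_minReps_unique cs hJ hb.2 hu hb'.2 hu' he
    exact Prod.ext h2 h1
  · intro y hy
    obtain ⟨b, hb, u, hu, rfl⟩ := exists_mul_minReps cs hJ y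
    exact ⟨(u, b), Finset.mem_product.2
      ⟨hu, (mem_relMinReps cs).2 ⟨(key b u hu hb).1 hy, hb⟩⟩, rfl⟩
  · rintro ⟨u, b⟩ -
    rw [← map_mul, mul_inv_rev]

open Classical in
/-- The minimal length representatives of the `W_J`-`W_K` double cosets. -/
noncomputable def doubleReps (J K : Finset W) : Finset W :=
  (minReps cs J).filter fun d => d⁻¹ ∈ minReps cs K

theorem mem_doubleReps {d : W} :
    d ∈ doubleReps cs J K ↔ d ∈ minReps cs J ∧ d⁻¹ ∈ minReps cs K := by
  simp [doubleReps]

theorem inv_mul_mem_minReps_iff (hJ : J ⊆ simples cs) (hK : K ⊆ simples cs) {d b : W}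
    (hd : d ∈ doubleReps cs J K) (hb : b ∈ Subgroup.closure (J : Set W)) :
    d⁻¹ * b ∈ minReps cs K ↔ b ∈ minReps cs (J.filter fun s => d⁻¹ * s * d ∈ K) := by
  rw [mem_doubleReps] at hd
  have hK' := coe_subset_range cs hK
  have hJ' := coe_subset_range cs hJ
  rw [mem_minReps cs hK, mem_minReps cs ((Finset.filter_subset _ _).trans hJ)]
  have key : ∀ k ∈ K, (cs.IsLeftInversion (d⁻¹ * b) k ↔ cs.IsLeftInversion b (d * k * d⁻¹)) := by
    intro k hk
    rw [isLeftInversion_mul_iff cs (isReflection_of_mem_range cs (hK' hk)),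
      not_iff, iff_true_left ((mem_minReps cs hK).1 hd.2 k hk), inv_inv]
  constructor
  · intro h s hs hbs
    rw [Finset.mem_filter] at hs
    refine h _ hs.2 ((key _ hs.2).2 ?_)
    convert hbs using 1
    group
  · intro h k hk hbk
    rw [key k hk] at hbk
    have ht := mem_closure_of_isLeftInversion cs hJ' hb hbk
    -- Both `d * k = (d * k * d⁻¹) * d` and `k * d⁻¹`, the inverse of `d * k`, are length-additive
    -- factorizations; comparing them shows that the conjugate is simple.
    have hl : cs.length (d * k * d⁻¹) = 1 := by
      have h1 := length_mul_of_mem_minReps cs hJ ht hd.1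
      have h2 := length_mul_of_mem_minReps cs hK (Subgroup.subset_closure hk) hd.2
      rw [← cs.length_inv (k * d⁻¹), mul_inv_rev, inv_inv, inv_of_mem_range cs (hK' hk),
        length_of_mem_range cs (hK' hk), cs.length_inv] at h2
      rw [inv_mul_cancel_right] at h1
      omega
    obtain ⟨i, hi⟩ := cs.length_eq_one_iff.1 hl
    have hm := mem_of_mem_closure_of_mem_range cs hJ' ⟨i, hi.symm⟩ ht
    refine h _ (Finset.mem_filter.2 ⟨hm, ?_⟩) hbk
    convert hk using 1
    group

theorem xElt_eq_sum_doubleReps (hJ : J ⊆ simples cs) (hK : K ⊆ simples cs) :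
    xElt cs K = ∑ d ∈ doubleReps cs J K,
      ∑ b ∈ relMinReps cs J (J.filter fun s => d⁻¹ * s * d ∈ K),
        MonoidAlgebra.of ℚ W b⁻¹ * MonoidAlgebra.of ℚ W d := by
  symm
  rw [xElt, Finset.sum_sigma']
  refine Finset.sum_bij (fun p _ => p.1⁻¹ * p.2) ?_ ?_ ?_ ?_
  · rintro ⟨d, b⟩ h
    obtain ⟨hd, hb⟩ := Finset.mem_sigma.1 h
    rw [mem_relMinReps] at hb
    exact (inv_mul_mem_minReps_iff cs hJ hK hd hb.2).2 hb.1
  · rintro ⟨d, b⟩ h ⟨d', b'⟩ h' he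
    obtain ⟨hd, hb⟩ := Finset.mem_sigma.1 h
    obtain ⟨hd', hb'⟩ := Finset.mem_sigma.1 h'
    rw [mem_relMinReps] at hb hb'
    rw [mem_doubleReps] at hd hd'
    have he' := congrArg (·⁻¹) he
    simp only [mul_inv_rev, inv_inv] at he'
    obtain ⟨h1, h2⟩ := mul_minReps_unique cs hJ (inv_mem hb.2) hd.1 (inv_mem hb'.2) hd'.1 he'
    dsimp only at h1 h2
    rw [inv_inj] at h1
    subst h1 h2
    rfl
  · intro v hv
    obtain ⟨a, ha, d, hd, hv'⟩ := exists_mul_minReps cs hJ v⁻¹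
    obtain rfl : v = d⁻¹ * a⁻¹ := by rw [← mul_inv_rev, ← hv', inv_inv]
    -- Because `ℓ(v) = ℓ(a) + ℓ(d)`, an element of `K` shortening `d⁻¹` would also shorten `v = d⁻¹
    -- * a⁻¹`.
    have hdK : d ∈ doubleReps cs J K := by
      refine (mem_doubleReps cs).2 ⟨hd, (mem_minReps cs hK).2 fun k hk hlt => ?_⟩
      refine (mem_minReps cs hK).1 hv k hk ?_
      have hk' := coe_subset_range cs hK hk
      rw [isLeftInversion_iff_length_lt cs hk'] at hlt ⊢
      have h1 := length_mul_of_mem_minReps cs hJ ha hd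
      rw [← cs.length_inv (a * d), mul_inv_rev] at h1
      have h2 := cs.length_mul_le (k * d⁻¹) a⁻¹
      rw [mul_assoc] at h2
      rw [cs.length_inv] at h2 hlt
      omega
    exact ⟨⟨d, a⁻¹⟩, Finset.mem_sigma.2 ⟨hdK, (mem_relMinReps cs).2
      ⟨(inv_mul_mem_minReps_iff cs hJ hK hdK (inv_mem ha)).1 hv, inv_mem ha⟩⟩, rfl⟩
  · rintro ⟨d, b⟩ -
    rw [← map_mul, mul_inv_rev, inv_inv]

/-- Solomon's product formula. -/
theorem xElt_mul_xElt (hJ : J ⊆ simples cs) (hK : K ⊆ simples cs) :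
    xElt cs J * xElt cs K =
      ∑ d ∈ doubleReps cs J K, xElt cs (conj (J.filter fun s => d⁻¹ * s * d ∈ K) d) := by
  rw [xElt_eq_sum_doubleReps cs hJ hK, Finset.mul_sum]
  refine Finset.sum_congr rfl fun d hd => ?_
  have hI : (J.filter fun s => d⁻¹ * s * d ∈ K) ⊆ J := Finset.filter_subset _ _
  have hd' : d ∈ minReps cs (J.filter fun s => d⁻¹ * s * d ∈ K) := by
    rw [mem_minReps cs (hI.trans hJ)]
    exact fun s hs => (mem_minReps cs hJ).1 ((mem_doubleReps cs).1 hd).1 s (hI hs)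
  have hc : conj (J.filter fun s => d⁻¹ * s * d ∈ K) d ⊆ simples cs := by
    intro r hr
    obtain ⟨s, hs, rfl⟩ := mem_conj.1 hr
    exact hK (Finset.mem_filter.1 hs).2
  -- With `I = J ∩ d K d⁻¹`, the factor `x_J` turns the sum over `b` into `x_I`, and `x_I d =
  -- x_{I^d}`.
  rw [← xElt_mul_of cs (hI.trans hJ) hd' hc, xElt_eq_mul_relMinReps cs hJ hI, mul_assoc,
    Finset.sum_mul]

/-- Solomon's theorem: `Σ(W)` is closed under multiplication. -/
theorem descentAlgebra_mul_self : descentAlgebra cs * descentAlgebra cs ≤ descentAlgebra cs := by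
  conv_lhs => rw [descentAlgebra, Submodule.span_mul_span]
  rw [Submodule.span_le]
  rintro _ ⟨_, ⟨J, hJ, rfl⟩, _, ⟨K, hK, rfl⟩, rfl⟩
  simp only [xElt_mul_xElt cs hJ hK]
  refine Submodule.sum_mem _ fun d _ => Submodule.subset_span ⟨_, ?_, rfl⟩
  intro r hr
  obtain ⟨s, hs, rfl⟩ := mem_conj.1 hr
  exact hK (Finset.mem_filter.1 hs).2

end Product
end DescentAlgebra

namespace DescentAlgebra

/-! ### Longest elements and inclusion-exclusion -/

section Longest

variable {B W : Type*} [Group W] {M : CoxeterMatrix B} (cs : CoxeterSystem M W) {J : Set W}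

/-- A standard parabolic subgroup of a finite Coxeter group contains an element which has all
reflections of the subgroup as inversions. -/
theorem exists_forall_isLeftInversion [Finite W] (J : Set W) :
    ∃ w ∈ Subgroup.closure J,
      ∀ t ∈ Subgroup.closure J, cs.IsReflection t → cs.IsLeftInversion w t := by
  obtain ⟨w, hw, hmax⟩ := Set.exists_max_image (Subgroup.closure J : Set W) cs.length
    (Set.toFinite _) ⟨1, one_mem _⟩
  exact ⟨w, hw, fun t ht hr =>
    ⟨hr, lt_of_le_of_ne (hmax _ (mul_mem ht hw)) (hr.length_mul_right_ne w)⟩⟩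

variable (hJ : J ⊆ Set.range cs.simple) {w : W} (hw : w ∈ Subgroup.closure J)
  (hmax : ∀ t ∈ Subgroup.closure J, cs.IsReflection t → cs.IsLeftInversion w t)

include hJ hw hmax

theorem longest_mul_self : w * w = 1 := by
  have h := length_mul_of_forall_isLeftInversion cs hJ hw hmax
  exact cs.length_eq_zero_iff.1 (by omega)

/-- The complementary length formula, applied to `s` and then to `w * s`, shows that `w * s * w` has
length one. -/
theorem longest_conj_mem {s : W} (hs : s ∈ J) : w⁻¹ * s * w ∈ J := by
  have hi : w⁻¹ = w := inv_eq_of_mul_eq_one_left (longest_mul_self cs hJ hw hmax)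
  have hs' := Subgroup.subset_closure hs
  have h1 := length_mul_of_forall_isLeftInversion cs hJ hs' hmax
  have h2 := length_mul_of_forall_isLeftInversion cs hJ (mul_mem hw hs') hmax
  rw [← cs.length_inv (w * s), mul_inv_rev, inv_of_mem_range cs (hJ hs), hi] at h2
  rw [length_of_mem_range cs (hJ hs)] at h1
  obtain ⟨i, h3⟩ := cs.length_eq_one_iff.1 (show cs.length (w * s * w) = 1 by omega)
  rw [hi]
  exact mem_of_mem_closure_of_mem_range cs hJ ⟨i, h3.symm⟩ (mul_mem (mul_mem hw hs') hw)

end Longest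

section LongestElement

variable {B W : Type*} [Group W] {M : CoxeterMatrix B} (cs : CoxeterSystem M W) {w₀ : W}
  (hw₀ : ∀ w : W, cs.length w ≤ cs.length w₀)

include hw₀

theorem isLeftInversion_longest {t : W} (ht : cs.IsReflection t) : cs.IsLeftInversion w₀ t :=
  ⟨ht, lt_of_le_of_ne (hw₀ _) (ht.length_mul_right_ne w₀)⟩

theorem longestElement_mul_self : w₀ * w₀ = 1 :=
  longest_mul_self cs subset_rfl (by simp [cs.subgroup_closure_range_simple])
    fun _ _ => isLeftInversion_longest cs hw₀

theorem isLeftInversion_mul_longest_iff {t : W} (ht : cs.IsReflection t) (a : W) :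
    cs.IsLeftInversion (a * w₀) t ↔ ¬cs.IsLeftInversion a t := by
  rw [isLeftInversion_mul_iff cs ht, iff_true_right (isLeftInversion_longest cs hw₀ ?_)]
  simpa using ht.conj a⁻¹

end LongestElement

theorem sum_Icc_neg_one_pow_card {α : Type*} [DecidableEq α] {L T : Finset α} (h : L ⊆ T) :
    ∑ J ∈ Finset.Icc L T, (-1 : ℚ) ^ J.card = if T = L then (-1) ^ L.card else 0 := by
  have h1 : ∀ J ∈ (T \ L).powerset, Disjoint L J := fun J hJ =>
    Finset.disjoint_sdiff.mono_right (Finset.mem_powerset.1 hJ)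
  rw [Finset.Icc_eq_image_powerset h, Finset.sum_image]
  · have h2 : ∀ J ∈ (T \ L).powerset,
        (-1 : ℚ) ^ (L ∪ J).card = (-1) ^ L.card * ((-1 : ℤ) ^ J.card : ℤ) := by
      intro J hJ
      rw [Finset.card_union_of_disjoint (h1 J hJ), pow_add]
      simp
    rw [Finset.sum_congr rfl h2, ← Finset.mul_sum, ← Int.cast_sum,
      Finset.sum_powerset_neg_one_pow_card]
    have h3 : T \ L = ∅ ↔ T = L := by
      rw [Finset.sdiff_eq_empty_iff_subset]
      exact ⟨fun h' => h'.antisymm h, fun h' => h'.subset⟩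
    simp only [h3]
    split_ifs <;> simp
  · intro J hJ J' hJ' he
    have := congrArg (· \ L) he
    simpa [Finset.union_sdiff_left, (h1 J hJ).symm.sdiff_eq_left,
      (h1 J' hJ').symm.sdiff_eq_left] using this

/-! ### The eigenvector relation for `e_L` -/

section Eigen

variable {B W : Type*} [Group W] [Fintype W] [DecidableEq W] {M : CoxeterMatrix B}
  (cs : CoxeterSystem M W) {J K L : Finset W}

open Classical in
/-- The elements of `K` that are not left descents of `x`. -/
noncomputable def ascents (K : Finset W) (x : W) : Finset W :=
  K.filter fun s => ¬cs.IsLeftInversion x s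

omit [Fintype W] [DecidableEq W] in
theorem mem_ascents {x s : W} : s ∈ ascents cs K x ↔ s ∈ K ∧ ¬cs.IsLeftInversion x s := by
  simp [ascents]

theorem mem_minReps_iff_subset_ascents (hK : K ⊆ simples cs) (hJ : J ⊆ K) {x : W} :
    x ∈ minReps cs J ↔ J ⊆ ascents cs K x := by
  rw [mem_minReps cs (hJ.trans hK)]
  exact forall₂_congr fun s hs => by simp [mem_ascents, hJ hs]

variable {w₀ : W} (hw₀ : ∀ w : W, cs.length w ≤ cs.length w₀)

include hw₀

theorem ascents_mul_longest_eq_empty_iff (hK : K ⊆ simples cs) {x : W} :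
    ascents cs K (x * w₀) = ∅ ↔ x ∈ minReps cs K := by
  rw [mem_minReps cs hK, Finset.eq_empty_iff_forall_notMem]
  refine forall_congr' fun s => ?_
  rw [mem_ascents, not_and, not_not]
  refine imp_congr_right fun hs => ?_
  exact isLeftInversion_mul_longest_iff cs hw₀
    (isReflection_of_mem_range cs (coe_subset_range cs hK hs)) x

/-- The left side sums `y⁻¹` over all `y` without ascents in `K`. On the right, `x⁻¹` has as
coefficient the alternating sum over the subsets of its ascents in `K`, which vanishes unless there
are none. -/
theorem longest_mul_xElt (hK : K ⊆ simples cs) :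
    MonoidAlgebra.of ℚ W w₀ * xElt cs K =
      ∑ J ∈ K.powerset, (-1 : ℚ) ^ J.card • xElt cs J := by
  have hinv : w₀⁻¹ = w₀ := inv_eq_of_mul_eq_one_left (longestElement_mul_self cs hw₀)
  have h1 : MonoidAlgebra.of ℚ W w₀ * xElt cs K =
      ∑ y ∈ Finset.univ.filter (fun y => ascents cs K y = ∅), MonoidAlgebra.of ℚ W y⁻¹ := by
    rw [xElt, Finset.mul_sum]
    refine Finset.sum_bij' (fun x _ => x * w₀) (fun y _ => y * w₀) ?_ ?_ ?_ ?_ ?_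
    · intro x hx
      simpa [ascents_mul_longest_eq_empty_iff cs hw₀ hK] using hx
    · intro y hy
      rw [← ascents_mul_longest_eq_empty_iff cs hw₀ hK, mul_assoc,
        longestElement_mul_self cs hw₀, mul_one]
      simpa using hy
    · intro x _
      rw [mul_assoc, longestElement_mul_self cs hw₀, mul_one]
    · intro x _
      rw [mul_assoc, longestElement_mul_self cs hw₀, mul_one]
    · intro x _
      rw [← map_mul, mul_inv_rev, hinv]
  have h2 : ∀ J ∈ K.powerset, (-1 : ℚ) ^ J.card • xElt cs J =
      ∑ x, if J ⊆ ascents cs K x then (-1 : ℚ) ^ J.card • MonoidAlgebra.of ℚ W x⁻¹ else 0 := by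
    intro J hJ
    rw [xElt, Finset.smul_sum, ← Finset.sum_filter]
    refine Finset.sum_congr ?_ fun _ _ => rfl
    ext x
    simp [mem_minReps_iff_subset_ascents cs hK (Finset.mem_powerset.1 hJ)]
  rw [h1, Finset.sum_congr rfl h2, Finset.sum_comm, Finset.sum_filter]
  refine Finset.sum_congr rfl fun x _ => ?_
  have h3 : K.powerset.filter (fun J => J ⊆ ascents cs K x) = Finset.Icc ∅ (ascents cs K x) := by
    ext J
    simp only [Finset.mem_filter, Finset.mem_powerset, Finset.mem_Icc,
      Finset.empty_subset, true_and, and_iff_right_iff_imp]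
    exact fun h => h.trans fun s hs => ((mem_ascents cs).1 hs).1
  rw [← Finset.sum_filter, h3, ← Finset.sum_smul, sum_Icc_neg_one_pow_card (Finset.empty_subset _)]
  split_ifs <;> simp

variable (hcentral : w₀ ∈ Subgroup.center W)

include hcentral

/-- Multiplication by the longest element of `W_L` on the left and by `w₀` on the right permutes
`X_L^♯`, and exchanges ascents and descents outside of `L`. -/
theorem longest_mul_mul_longest_mem_sharpReps (hL : L ⊆ simples cs) {w : W}
    (hw : w ∈ Subgroup.closure (L : Set W))
    (hmax : ∀ t ∈ Subgroup.closure (L : Set W), cs.IsReflection t → cs.IsLeftInversion w t)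
    {x : W} (hx : x ∈ sharpReps cs L) :
    w * x * w₀ ∈ sharpReps cs L ∧ ∀ s ∈ simples cs, s ∉ L →
      (cs.IsLeftInversion (w * x * w₀) s ↔ ¬cs.IsLeftInversion x s) := by
  have hL' := coe_subset_range cs hL
  obtain ⟨hxL, hxc⟩ := Finset.mem_filter.1 hx
  have hcomm := Subgroup.mem_center_iff.1 hcentral
  refine ⟨Finset.mem_filter.2 ⟨?_, ?_⟩, ?_⟩
  · rw [mem_minReps cs hL]
    intro s hs
    rw [isLeftInversion_mul_longest_iff cs hw₀ (isReflection_of_mem_range cs (hL' hs)), not_not,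
      isLeftInversion_mul_iff_of_mem_minReps cs hL hw hxL hs]
    exact hmax s (Subgroup.subset_closure hs) (isReflection_of_mem_range cs (hL' hs))
  · intro r hr
    obtain ⟨s, hs, rfl⟩ := mem_conj.1 hr
    refine hxc (mem_conj.2 ⟨_, longest_conj_mem cs hL' hw hmax hs, ?_⟩)
    -- Centrality removes the conjugation by `w₀`, so that `L^(w x w₀) = L^(w x) = L^x`.
    have h := hcomm (x⁻¹ * (w⁻¹ * s * w) * x)
    rw [show (w * x * w₀)⁻¹ * s * (w * x * w₀) = w₀⁻¹ * (x⁻¹ * (w⁻¹ * s * w) * x * w₀) by group,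
      h, inv_mul_cancel_left]
  · intro s hs hsL
    have hs' := (mem_simples cs).1 hs
    have hr := isReflection_of_mem_range cs hs'
    -- In `w x = x (x⁻¹ w x)` the second factor lies in `W_{L^x}`, as do its inversions; since `s ∉
    -- L`, `x⁻¹ s x` is not among them.
    rw [isLeftInversion_mul_longest_iff cs hw₀ hr, not_iff_not,
      show w * x = x * (x⁻¹ * w * x) by group, isLeftInversion_mul_iff cs hr]
    have hwx : x⁻¹ * w * x ∈ Subgroup.closure (conj L x : Set W) :=
      conj_mem_closure_conj x hw
    have hn : ¬cs.IsLeftInversion (x⁻¹ * w * x) (x⁻¹ * s * x) := by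
      intro h
      have h1 := mem_closure_of_isLeftInversion cs (coe_subset_range cs hxc) hwx h
      have h2 := conj_mem_closure_conj x⁻¹ h1
      rw [conj_conj, mul_inv_cancel, conj_one] at h2
      exact hsL (mem_of_mem_closure_of_mem_range cs hL' hs' (by simpa [mul_assoc] using h2))
    simp [hn]

/-- Each `x ∈ X_L^♯` contributes the alternating sum over `L ⊆ J ⊆ ascents cs K x`, so it counts
only if its ascents in `K` are exactly `L`. The involution `x ↦ w_L x w₀` carries such `x` to the
elements with no descent in `K`. -/
theorem sum_neg_one_pow_mul_mCoeff (hK : K ⊆ simples cs) (hL : L ⊆ simples cs) :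
    ∑ J ∈ K.powerset, (-1 : ℚ) ^ J.card * mCoeff cs J L = (-1) ^ L.card * mCoeff cs K L := by
  by_cases hLK : L ⊆ K
  swap
  · rw [mCoeff, if_neg hLK, mul_zero]
    refine Finset.sum_eq_zero fun J hJ => ?_
    rw [mCoeff, if_neg fun h => hLK (h.trans (Finset.mem_powerset.1 hJ)), mul_zero]
  have h1 : ∀ J ∈ K.powerset, (-1 : ℚ) ^ J.card * mCoeff cs J L =
      ∑ x ∈ sharpReps cs L, if L ⊆ J ∧ J ⊆ ascents cs K x then (-1 : ℚ) ^ J.card else 0 := by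
    intro J hJ
    rw [mCoeff]
    split_ifs with hLJ
    · rw [Finset.inter_comm, ← Finset.filter_mem_eq_inter, Finset.card_filter, Nat.cast_sum,
        Finset.mul_sum]
      refine Finset.sum_congr rfl fun x _ => ?_
      simp [hLJ, mem_minReps_iff_subset_ascents cs hK (Finset.mem_powerset.1 hJ)]
    · simp [hLJ]
  have h2 : ∀ x ∈ sharpReps cs L, L ⊆ ascents cs K x := fun x hx =>
    (mem_minReps_iff_subset_ascents cs hK hLK).1 (Finset.mem_filter.1 hx).1
  have h3 : ∀ x ∈ sharpReps cs L, (∑ J ∈ K.powerset,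
      if L ⊆ J ∧ J ⊆ ascents cs K x then (-1 : ℚ) ^ J.card else 0) =
        if ascents cs K x = L then (-1) ^ L.card else 0 := by
    intro x hx
    rw [← sum_Icc_neg_one_pow_card (h2 x hx), ← Finset.sum_filter]
    refine Finset.sum_congr ?_ fun _ _ => rfl
    ext J
    simp only [Finset.mem_filter, Finset.mem_powerset, Finset.mem_Icc,
      and_iff_right_iff_imp]
    exact fun h => h.2.trans fun s hs => ((mem_ascents cs).1 hs).1
  rw [Finset.sum_congr rfl h1, Finset.sum_comm, Finset.sum_congr rfl h3, ← Finset.sum_filter,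
    Finset.sum_const, nsmul_eq_mul, mul_comm, mCoeff, if_pos hLK, Finset.inter_comm,
    ← Finset.filter_mem_eq_inter]
  congr 2
  obtain ⟨w, hw, hmax⟩ := exists_forall_isLeftInversion cs (L : Set W)
  have hww := longest_mul_self cs (coe_subset_range cs hL) hw hmax
  have hw₀w₀ := longestElement_mul_self cs hw₀
  have hinvol : ∀ x, w * (w * x * w₀) * w₀ = x := by
    intro x
    rw [mul_assoc w x, ← mul_assoc, hww, one_mul, mul_assoc, hw₀w₀, mul_one]
  have hmem := fun {x : W} (hx : x ∈ sharpReps cs L) =>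
    longest_mul_mul_longest_mem_sharpReps cs hw₀ hcentral hL hw hmax hx
  refine Finset.card_nbij' (fun x => w * x * w₀) (fun x => w * x * w₀) ?_ ?_
    (fun x _ => hinvol x) (fun x _ => hinvol x)
  · intro x hx
    simp only [Finset.coe_filter, Set.mem_ofPred_eq] at hx ⊢
    obtain ⟨h4, h5⟩ := hmem hx.1
    refine ⟨h4, (mem_minReps cs hK).2 fun s hs => ?_⟩
    by_cases hsL : s ∈ L
    · exact (mem_minReps cs hL).1 (Finset.mem_filter.1 h4).1 s hsL
    · rw [h5 s (hK hs) hsL, not_not]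
      by_contra hn
      exact hsL (hx.2 ▸ (mem_ascents cs).2 ⟨hs, hn⟩)
  · intro x hx
    simp only [Finset.coe_filter, Set.mem_ofPred_eq] at hx ⊢
    obtain ⟨h4, h5⟩ := hmem hx.1
    refine ⟨h4, (h2 _ h4).antisymm' fun s hs => ?_⟩
    obtain ⟨hsK, hn⟩ := (mem_ascents cs).1 hs
    by_contra hsL
    rw [h5 s (hK hsK) hsL, not_not] at hn
    exact (mem_minReps cs hK).1 hx.2 s hsK hn

/-- The elements `e_L` are eigenvectors of a central longest element. -/
theorem longest_mul_eElt (hL : L ⊆ simples cs) :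
    MonoidAlgebra.of ℚ W w₀ * eElt cs L = (-1 : ℚ) ^ L.card • eElt cs L := by
  have hsq : MonoidAlgebra.of ℚ W w₀ * MonoidAlgebra.of ℚ W w₀ = 1 := by
    rw [← map_mul, longestElement_mul_self cs hw₀, map_one]
  -- The family `(-1)^|L| w₀ e_L` solves the system that determines the `e_L`.
  have key : ∀ K ⊆ simples cs, xElt cs K = ∑ L ∈ (simples cs).powerset,
      mCoeff cs K L • ((-1 : ℚ) ^ L.card • (MonoidAlgebra.of ℚ W w₀ * eElt cs L)) := by
    intro K hK
    have h1 : MonoidAlgebra.of ℚ W w₀ * xElt cs K = ∑ L ∈ (simples cs).powerset,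
        ((-1 : ℚ) ^ L.card * mCoeff cs K L) • eElt cs L := by
      rw [longest_mul_xElt cs hw₀ hK]
      have h2 : ∀ J ∈ K.powerset, (-1 : ℚ) ^ J.card • xElt cs J =
          ∑ L ∈ (simples cs).powerset, ((-1 : ℚ) ^ J.card * mCoeff cs J L) • eElt cs L := by
        intro J hJ
        rw [xElt_eq_sum cs ((Finset.mem_powerset.1 hJ).trans hK), Finset.smul_sum]
        simp only [smul_smul]
      rw [Finset.sum_congr rfl h2, Finset.sum_comm]
      refine Finset.sum_congr rfl fun L hL => ?_
      rw [← Finset.sum_smul,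
        sum_neg_one_pow_mul_mCoeff cs hw₀ hcentral hK (Finset.mem_powerset.1 hL)]
    calc xElt cs K = MonoidAlgebra.of ℚ W w₀ * (MonoidAlgebra.of ℚ W w₀ * xElt cs K) := by
          rw [← mul_assoc, hsq, one_mul]
      _ = _ := by
          rw [h1, Finset.mul_sum]
          refine Finset.sum_congr rfl fun L _ => ?_
          rw [mul_smul_comm, smul_smul, mul_comm]
  have h := eElt_unique cs _ key hL
  nth_rw 2 [← h]
  rw [smul_smul, ← mul_pow]
  simp

end Eigen
end DescentAlgebra

namespace DescentAlgebra

/-! ### Classes of subsets and the elements `e_λ` -/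

section Shapes

variable {B W : Type*} [Group W] [Fintype W] [DecidableEq W] {M : CoxeterMatrix B}
  (cs : CoxeterSystem M W) {J K L : Finset W}

theorem mem_shape : K ∈ shape cs J ↔
    ∃ x ∈ minReps cs J, conj J x ⊆ simples cs ∧ conj J x = K := by
  simp [shape, sharpReps, and_assoc]

theorem subset_simples_of_mem_shape (h : K ∈ shape cs J) : K ⊆ simples cs := by
  obtain ⟨x, -, hx, rfl⟩ := (mem_shape cs).1 h
  exact hx

theorem one_mem_minReps (hJ : J ⊆ simples cs) : 1 ∈ minReps cs J :=
  (mem_minReps cs hJ).2 fun s _ => not_isLeftInversion_one cs s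

theorem self_mem_shape (hJ : J ⊆ simples cs) : J ∈ shape cs J :=
  (mem_shape cs).2 ⟨1, one_mem_minReps cs hJ, by rwa [conj_one], conj_one J⟩

theorem mem_shape_symm (hJ : J ⊆ simples cs) (h : K ∈ shape cs J) : J ∈ shape cs K := by
  obtain ⟨x, hx, hc, rfl⟩ := (mem_shape cs).1 h
  refine (mem_shape cs).2 ⟨x⁻¹, ?_, ?_⟩
  · rw [← mul_mem_minReps_iff cs hJ hx hc, mul_inv_cancel]
    exact one_mem_minReps cs hJ
  · rw [conj_conj, mul_inv_cancel, conj_one]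
    exact ⟨hJ, rfl⟩

theorem mem_shape_trans (hJ : J ⊆ simples cs) (h : K ∈ shape cs J) (h' : L ∈ shape cs K) :
    L ∈ shape cs J := by
  obtain ⟨x, hx, hc, rfl⟩ := (mem_shape cs).1 h
  obtain ⟨y, hy, hc', rfl⟩ := (mem_shape cs).1 h'
  rw [conj_conj] at hc' ⊢
  exact (mem_shape cs).2 ⟨x * y, (mul_mem_minReps_iff cs hJ hx hc y).2 hy, hc', rfl⟩

theorem shape_eq_iff_mem (hJ : J ⊆ simples cs) (hK : K ⊆ simples cs) :
    shape cs K = shape cs J ↔ K ∈ shape cs J := by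
  refine ⟨fun h => h ▸ self_mem_shape cs hK, fun h => ?_⟩
  ext L
  exact ⟨mem_shape_trans cs hJ h, mem_shape_trans cs hK (mem_shape_symm cs hJ h)⟩

/-- The classes partition the set of subsets of `S`. -/
theorem sum_shapes {A : Type*} [AddCommMonoid A] (f : Finset W → A) :
    ∑ lam ∈ shapes cs, ∑ L ∈ lam, f L = ∑ L ∈ (simples cs).powerset, f L := by
  rw [← Finset.sum_fiberwise_of_maps_to (g := shape cs) (t := shapes cs)
    (fun J hJ => Finset.mem_image_of_mem _ hJ)]
  refine Finset.sum_congr rfl fun lam hlam => Finset.sum_congr ?_ fun _ _ => rfl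
  obtain ⟨J, hJ, rfl⟩ := Finset.mem_image.1 hlam
  rw [Finset.mem_powerset] at hJ
  ext K
  rw [Finset.mem_filter, Finset.mem_powerset]
  exact ⟨fun h => ⟨subset_simples_of_mem_shape cs h,
    (shape_eq_iff_mem cs hJ (subset_simples_of_mem_shape cs h)).2 h⟩,
    fun h => (shape_eq_iff_mem cs hJ h.1).1 h.2⟩

theorem minReps_simples : minReps cs (simples cs) = {1} := by
  ext x
  rw [Finset.mem_singleton]
  constructor
  · intro h
    by_contra h1
    obtain ⟨i, hi⟩ := cs.exists_leftDescent_of_ne_one h1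
    rw [← cs.isLeftInversion_simple_iff_isLeftDescent] at hi
    exact (mem_minReps cs subset_rfl).1 h _ ((mem_simples cs).2 ⟨i, rfl⟩) hi
  · rintro rfl
    exact one_mem_minReps cs subset_rfl

/-- This is the defining relation for `K = S`: since `X_S = {1}`, `x_S = 1` and every `m_{SL}`
equals one. -/
theorem sum_eShape : ∑ lam ∈ shapes cs, eShape cs lam = 1 := by
  have h := xElt_eq_sum cs (subset_refl (simples cs))
  rw [xElt, minReps_simples, Finset.sum_singleton, inv_one, map_one] at h
  simp only [eShape]
  rw [sum_shapes, h]
  refine Finset.sum_congr rfl fun L hL => ?_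
  rw [Finset.mem_powerset] at hL
  have h1 : (1 : W) ∈ sharpReps cs L :=
    Finset.mem_filter.2 ⟨one_mem_minReps cs hL, by rwa [conj_one]⟩
  rw [mCoeff, if_pos hL, minReps_simples, Finset.singleton_inter_of_mem h1]
  simp

theorem eElt_mem_descentAlgebra (hK : K ⊆ simples cs) : eElt cs K ∈ descentAlgebra cs := by
  induction K using Finset.strongInduction with
  | H K ih =>
    rw [eElt]
    refine Submodule.smul_mem _ _ (Submodule.sub_mem _ (Submodule.subset_span ⟨K, hK, rfl⟩)
      (Submodule.sum_mem _ fun L _ => Submodule.smul_mem _ _ ?_))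
    have hL := Finset.mem_ssubsets.1 L.2
    exact ih L.1 hL (hL.1.trans hK)

theorem eShape_mem_descentAlgebra {lam : Finset (Finset W)} (h : lam ∈ shapes cs) :
    eShape cs lam ∈ descentAlgebra cs := by
  obtain ⟨J, -, rfl⟩ := Finset.mem_image.1 h
  exact Submodule.sum_mem _ fun L hL =>
    eElt_mem_descentAlgebra cs (subset_simples_of_mem_shape cs hL)

theorem one_mem_descentAlgebra : 1 ∈ descentAlgebra cs := by
  rw [← sum_eShape cs]
  exact Submodule.sum_mem _ fun _ => eShape_mem_descentAlgebra cs

variable {w₀ : W} (hw₀ : ∀ w : W, cs.length w ≤ cs.length w₀)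
  (hcentral : w₀ ∈ Subgroup.center W)

include hw₀ hcentral

theorem longest_mul_eShape {lam : Finset (Finset W)} (h : lam ∈ shapes cs) :
    MonoidAlgebra.of ℚ W w₀ * eShape cs lam = (-1 : ℚ) ^ shapeNorm lam • eShape cs lam := by
  obtain ⟨J, -, rfl⟩ := Finset.mem_image.1 h
  rw [eShape, Finset.mul_sum, Finset.smul_sum]
  refine Finset.sum_congr rfl fun L hL => ?_
  rw [longest_mul_eElt cs hw₀ hcentral (subset_simples_of_mem_shape cs hL),
    shapeNorm_eq_card cs hL]

theorem longest_eq_sum : MonoidAlgebra.of ℚ W w₀ =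
    ∑ lam ∈ shapes cs, ((-1 : ℚ) ^ shapeNorm lam) • eShape cs lam := by
  conv_lhs => rw [← mul_one (MonoidAlgebra.of ℚ W w₀), ← sum_eShape cs, Finset.mul_sum]
  exact Finset.sum_congr rfl fun lam => longest_mul_eShape cs hw₀ hcentral

theorem epsPlus_mul_eShape {lam : Finset (Finset W)} (h : lam ∈ shapes cs) :
    epsPlus w₀ * eShape cs lam = if Even (shapeNorm lam) then eShape cs lam else 0 := by
  rw [epsPlus, smul_mul_assoc, add_mul, one_mul, longest_mul_eShape cs hw₀ hcentral h]
  split_ifs with he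
  · rw [he.neg_one_pow]
    module
  · rw [(Nat.not_even_iff_odd.1 he).neg_one_pow]
    module

theorem epsMinus_mul_eShape {lam : Finset (Finset W)} (h : lam ∈ shapes cs) :
    epsMinus w₀ * eShape cs lam = if Odd (shapeNorm lam) then eShape cs lam else 0 := by
  rw [epsMinus, smul_mul_assoc, sub_mul, one_mul, longest_mul_eShape cs hw₀ hcentral h]
  split_ifs with he
  · rw [he.neg_one_pow]
    module
  · rw [(Nat.not_odd_iff_even.1 he).neg_one_pow]
    module

theorem epsPlus_eq_sum :
    epsPlus w₀ = ∑ lam ∈ shapes cs with Even (shapeNorm lam), eShape cs lam := by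
  rw [Finset.sum_filter, ← mul_one (epsPlus w₀), ← sum_eShape cs, Finset.mul_sum]
  exact Finset.sum_congr rfl fun lam => epsPlus_mul_eShape cs hw₀ hcentral

theorem epsMinus_eq_sum :
    epsMinus w₀ = ∑ lam ∈ shapes cs with Odd (shapeNorm lam), eShape cs lam := by
  rw [Finset.sum_filter, ← mul_one (epsMinus w₀), ← sum_eShape cs, Finset.mul_sum]
  exact Finset.sum_congr rfl fun lam => epsMinus_mul_eShape cs hw₀ hcentral

end Shapes

/-! ### The idempotents `(1 ± w₀) / 2` -/

section Central

variable {W : Type*} [Group W] {w : W}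

theorem epsPlus_add_epsMinus (w : W) : epsPlus w + epsMinus w = 1 := by
  rw [epsPlus, epsMinus]
  module

theorem of_mul_self_eq_one (hw : w * w = 1) :
    MonoidAlgebra.of ℚ W w * MonoidAlgebra.of ℚ W w = 1 := by
  rw [← map_mul, hw, map_one]

theorem epsPlus_mul_self (hw : w * w = 1) : epsPlus w * epsPlus w = epsPlus w := by
  rw [epsPlus, smul_mul_smul_comm, add_mul, mul_add, mul_add, of_mul_self_eq_one hw, one_mul,
    one_mul, mul_one]
  module

theorem epsMinus_mul_self (hw : w * w = 1) : epsMinus w * epsMinus w = epsMinus w := by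
  rw [epsMinus, smul_mul_smul_comm, sub_mul, mul_sub, mul_sub, of_mul_self_eq_one hw, one_mul,
    one_mul, mul_one]
  module

theorem epsPlus_mul_epsMinus (hw : w * w = 1) : epsPlus w * epsMinus w = 0 := by
  rw [eq_sub_of_add_eq' (epsPlus_add_epsMinus w), mul_sub, mul_one, epsPlus_mul_self hw, sub_self]

theorem epsPlus_commute (hw : w ∈ Subgroup.center W) (a : MonoidAlgebra ℚ W) :
    Commute (epsPlus w) a :=
  ((Commute.one_left a).add_left (MonoidAlgebra.of_commute
    (fun g => (Subgroup.mem_center_iff.1 hw g).symm) a)).smul_left _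

theorem epsMinus_commute (hw : w ∈ Subgroup.center W) (a : MonoidAlgebra ℚ W) :
    Commute (epsMinus w) a :=
  ((Commute.one_left a).sub_left (MonoidAlgebra.of_commute
    (fun g => (Subgroup.mem_center_iff.1 hw g).symm) a)).smul_left _

theorem completeOrthogonalIdempotents_eps (hw : w * w = 1) (hc : w ∈ Subgroup.center W) :
    CompleteOrthogonalIdempotents ![epsPlus w, epsMinus w] := by
  have h0 := epsPlus_mul_epsMinus hw
  have h1 : epsMinus w * epsPlus w = 0 := (epsPlus_commute hc _).eq ▸ h0
  refine ⟨⟨?_, ?_⟩, ?_⟩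
  · intro i
    fin_cases i
    · exact epsPlus_mul_self hw
    · exact epsMinus_mul_self hw
  · intro i j hij
    fin_cases i <;> fin_cases j
    · exact (hij rfl).elim
    · exact h0
    · exact h1
    · exact (hij rfl).elim
  · simpa using epsPlus_add_epsMinus w

end Central

/-! ### Ideals cut out by central idempotents -/

section CentralIdempotent

variable {R A : Type*} [CommRing R] [Ring A] [Algebra R A] {D E : Submodule R A} {e f : A}

/-- Being central and the identity on `E`, `e` fixes `D * E * D`; conversely `e * a = 1 * e * a`
with `e ∈ E`. -/
theorem mul_mul_eq_map_mulLeft (hD : D * D ≤ D) (h1 : 1 ∈ D) (hc : ∀ a, Commute e a)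
    (heE : e ∈ E) (hED : E ≤ D) (hE : ∀ x ∈ E, e * x = x) :
    D * E * D = D.map (LinearMap.mulLeft R e) := by
  apply le_antisymm
  · intro x hx
    refine ⟨x, ?_, ?_⟩
    · exact ((mul_le_mul' ((mul_le_mul' le_rfl hED).trans hD) le_rfl).trans hD) hx
    · have h : D * E * D ≤ LinearMap.eqLocus (LinearMap.mulLeft R e) LinearMap.id := by
        rw [Submodule.mul_le]
        intro y hy c _
        have h' : D * E ≤ LinearMap.eqLocus (LinearMap.mulLeft R e) LinearMap.id := by
          rw [Submodule.mul_le]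
          intro a _ x hx
          change e * (a * x) = a * x
          rw [← mul_assoc, (hc a).eq, mul_assoc, hE x hx]
        have hy' : e * y = y := h' hy
        change e * (y * c) = y * c
        rw [← mul_assoc, hy']
      exact h hx
  · rintro _ ⟨a, ha, rfl⟩
    rw [LinearMap.mulLeft_apply, ← one_mul e]
    exact Submodule.mul_mem_mul (Submodule.mul_mem_mul h1 heE) ha

theorem map_mulLeft_le (hD : D * D ≤ D) (he : e ∈ D) : D.map (LinearMap.mulLeft R e) ≤ D := by
  rintro _ ⟨a, ha, rfl⟩
  exact hD (Submodule.mul_mem_mul he ha)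

theorem map_mulLeft_mul_le (hD : D * D ≤ D) :
    D.map (LinearMap.mulLeft R e) * D ≤ D.map (LinearMap.mulLeft R e) := by
  rw [Submodule.mul_le]
  rintro _ ⟨a, ha, rfl⟩ b hb
  exact ⟨a * b, hD (Submodule.mul_mem_mul ha hb), (mul_assoc e a b).symm⟩

theorem mul_map_mulLeft_le (hD : D * D ≤ D) (hc : ∀ a, Commute e a) :
    D * D.map (LinearMap.mulLeft R e) ≤ D.map (LinearMap.mulLeft R e) := by
  rw [Submodule.mul_le]
  rintro b hb _ ⟨a, ha, rfl⟩
  refine ⟨b * a, hD (Submodule.mul_mem_mul hb ha), ?_⟩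
  rw [LinearMap.mulLeft_apply, LinearMap.mulLeft_apply, ← mul_assoc, (hc b).eq, mul_assoc]

theorem map_mulLeft_sup_map_mulLeft (hD : D * D ≤ D) (he : e ∈ D) (hf : f ∈ D)
    (hef : e + f = 1) :
    D.map (LinearMap.mulLeft R e) ⊔ D.map (LinearMap.mulLeft R f) = D := by
  refine le_antisymm (sup_le (map_mulLeft_le hD he) (map_mulLeft_le hD hf)) fun a ha => ?_
  rw [← one_mul a, ← hef, add_mul]
  exact Submodule.add_mem_sup ⟨a, ha, rfl⟩ ⟨a, ha, rfl⟩

/-- A common element is both fixed and annihilated by `f`. -/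
theorem disjoint_map_mulLeft (hff : f * f = f) (hef : e * f = 0) (hc : ∀ a, Commute e a) :
    Disjoint (D.map (LinearMap.mulLeft R e)) (D.map (LinearMap.mulLeft R f)) := by
  rw [Submodule.disjoint_def]
  rintro _ ⟨a, -, rfl⟩ ⟨b, -, hb⟩
  rw [LinearMap.mulLeft_apply, LinearMap.mulLeft_apply] at hb
  rw [LinearMap.mulLeft_apply, ← hb, ← hff, mul_assoc, hb, ← mul_assoc, ← (hc f).eq, hef, zero_mul]

theorem map_mulLeft_mul_map_mulLeft (hef : e * f = 0) (hc : ∀ a, Commute f a) :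
    D.map (LinearMap.mulLeft R e) * D.map (LinearMap.mulLeft R f) = ⊥ := by
  rw [eq_bot_iff, Submodule.mul_le]
  rintro _ ⟨a, -, rfl⟩ _ ⟨b, -, rfl⟩
  rw [LinearMap.mulLeft_apply, LinearMap.mulLeft_apply, Submodule.mem_bot, (hc b).eq,
    mul_assoc e a, ← mul_assoc a, ← (hc (a * b)).eq, ← mul_assoc, hef, zero_mul]

end CentralIdempotent

end DescentAlgebra

/-! ### The main theorem -/

open DescentAlgebra in
theorem theorem1 {B W : Type*} [Group W] [Fintype W] [DecidableEq W] {M : CoxeterMatrix B}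
    (cs : CoxeterSystem M W) (w₀ : W) (hw₀ : ∀ w : W, cs.length w ≤ cs.length w₀)
    (hcentral : w₀ ∈ Subgroup.center W) :
    -- `e_μ Σ(W) e_λ = 0` whenever `|λ|` and `|μ|` have different parity
    (∀ lam ∈ shapes cs, ∀ mu ∈ shapes cs, ¬ shapeNorm lam ≡ shapeNorm mu [MOD 2] →
      ∀ a ∈ descentAlgebra cs, eShape cs mu * a * eShape cs lam = 0) ∧
    -- the expansion of `w₀`
    MonoidAlgebra.of ℚ W w₀ =
      ∑ lam ∈ shapes cs, ((-1 : ℚ) ^ shapeNorm lam) • eShape cs lam ∧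
    -- `(1 ± w₀) / 2` are complementary orthogonal idempotents, they lie in `Σ(W)` and are
    -- central in it, and they are the sums of the `e_λ` with `|λ|` even and odd
    CompleteOrthogonalIdempotents ![epsPlus w₀, epsMinus w₀] ∧
    epsPlus w₀ ∈ descentAlgebra cs ∧ epsMinus w₀ ∈ descentAlgebra cs ∧
    (∀ a ∈ descentAlgebra cs, Commute (epsPlus w₀) a ∧ Commute (epsMinus w₀) a) ∧
    epsPlus w₀ = ∑ lam ∈ shapes cs with Even (shapeNorm lam), eShape cs lam ∧
    epsMinus w₀ = ∑ lam ∈ shapes cs with Odd (shapeNorm lam), eShape cs lam ∧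
    -- the even and the odd part are cut out by these idempotents
    evenPart cs = (descentAlgebra cs).map (LinearMap.mulLeft ℚ (epsPlus w₀)) ∧
    oddPart cs = (descentAlgebra cs).map (LinearMap.mulLeft ℚ (epsMinus w₀)) ∧
    -- `Σ(W)` is the direct sum of the even and the odd part, as a vector space
    evenPart cs ⊔ oddPart cs = descentAlgebra cs ∧ Disjoint (evenPart cs) (oddPart cs) ∧
    -- and as an algebra: both parts are closed under multiplication by elements of `Σ(W)`
    -- on either side, and they annihilate each other
    descentAlgebra cs * evenPart cs ≤ evenPart cs ∧
    evenPart cs * descentAlgebra cs ≤ evenPart cs ∧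
    descentAlgebra cs * oddPart cs ≤ oddPart cs ∧
    oddPart cs * descentAlgebra cs ≤ oddPart cs ∧
    evenPart cs * oddPart cs = ⊥ ∧ oddPart cs * evenPart cs = ⊥ := by

  have hww := longestElement_mul_self cs hw₀
  have hp := epsPlus_eq_sum cs hw₀ hcentral
  have hm := epsMinus_eq_sum cs hw₀ hcentral
  have hpD : epsPlus w₀ ∈ descentAlgebra cs := hp ▸ Submodule.sum_mem _ fun lam hlam =>
    eShape_mem_descentAlgebra cs (Finset.mem_filter.1 hlam).1
  have hmD : epsMinus w₀ ∈ descentAlgebra cs := hm ▸ Submodule.sum_mem _ fun lam hlam =>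
    eShape_mem_descentAlgebra cs (Finset.mem_filter.1 hlam).1
  have hpc := epsPlus_commute hcentral
  have hmc := epsMinus_commute hcentral
  have hD := descentAlgebra_mul_self cs
  have h1D := one_mem_descentAlgebra cs
  have hpm := epsPlus_mul_epsMinus hww
  have hmp : epsMinus w₀ * epsPlus w₀ = 0 := (hpc _).eq ▸ hpm
  have heven : evenPart cs = (descentAlgebra cs).map (LinearMap.mulLeft ℚ (epsPlus w₀)) := by
    refine mul_mul_eq_map_mulLeft hD h1D hpc ?_ ?_ ?_
    · rw [hp]
      refine Submodule.sum_mem _ fun lam hlam => Submodule.subset_span ?_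
      rw [Finset.mem_filter] at hlam
      exact ⟨lam, hlam.1, hlam.2, rfl⟩
    · rw [Submodule.span_le]
      rintro _ ⟨lam, hlam, -, rfl⟩
      exact eShape_mem_descentAlgebra cs hlam
    · intro x hx
      refine Submodule.span_le (p := LinearMap.eqLocus (LinearMap.mulLeft ℚ (epsPlus w₀))
        LinearMap.id).2 ?_ hx
      rintro _ ⟨lam, hlam, he, rfl⟩
      exact (epsPlus_mul_eShape cs hw₀ hcentral hlam).trans (if_pos he)
  have hodd : oddPart cs = (descentAlgebra cs).map (LinearMap.mulLeft ℚ (epsMinus w₀)) := by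
    refine mul_mul_eq_map_mulLeft hD h1D hmc ?_ ?_ ?_
    · rw [hm]
      refine Submodule.sum_mem _ fun lam hlam => Submodule.subset_span ?_
      rw [Finset.mem_filter] at hlam
      exact ⟨lam, hlam.1, hlam.2, rfl⟩
    · rw [Submodule.span_le]
      rintro _ ⟨lam, hlam, -, rfl⟩
      exact eShape_mem_descentAlgebra cs hlam
    · intro x hx
      refine Submodule.span_le (p := LinearMap.eqLocus (LinearMap.mulLeft ℚ (epsMinus w₀))
        LinearMap.id).2 ?_ hx
      rintro _ ⟨lam, hlam, he, rfl⟩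
      exact (epsMinus_mul_eShape cs hw₀ hcentral hlam).trans (if_pos he)
  refine ⟨?_, longest_eq_sum cs hw₀ hcentral, completeOrthogonalIdempotents_eps hww hcentral, hpD,
    hmD, fun a _ => ⟨hpc a, hmc a⟩, hp, hm, heven, hodd, ?_⟩
  · intro lam hlam mu hmu hne a _
    have h1 := epsPlus_mul_eShape cs hw₀ hcentral hlam
    have h2 := epsPlus_mul_eShape cs hw₀ hcentral hmu
    -- The central `ε⁺` may act on either end; for opposite parities it fixes one of `e_μ`, `e_λ`
    -- and annihilates the other.
    have h3 : epsPlus w₀ * eShape cs mu * a * eShape cs lam =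
        eShape cs mu * a * (epsPlus w₀ * eShape cs lam) := by
      rw [mul_assoc, mul_assoc, (hpc _).eq]
      simp only [mul_assoc, (hpc (eShape cs lam)).eq]
    rw [h1, h2] at h3
    have hpar : Even (shapeNorm lam) ↔ ¬Even (shapeNorm mu) := by
      rw [Nat.ModEq] at hne
      rw [Nat.even_iff, Nat.even_iff]
      omega
    by_cases hev : Even (shapeNorm mu)
    · simpa [hev, hpar] using h3
    · simpa [hev, hpar] using h3.symm
  · rw [heven, hodd]
    exact ⟨map_mulLeft_sup_map_mulLeft hD hpD hmD (epsPlus_add_epsMinus w₀),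
      disjoint_map_mulLeft (epsMinus_mul_self hww) hpm hpc, mul_map_mulLeft_le hD hpc,
      map_mulLeft_mul_le hD, mul_map_mulLeft_le hD hmc, map_mulLeft_mul_le hD,
      map_mulLeft_mul_map_mulLeft hpm hmc, map_mulLeft_mul_map_mulLeft hmp hpc⟩
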